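/- The real Cayley–Dickson algebras are $A_0=\mathbb R$ and $A_{n+1}=A_n\times A_n$, with $\overline{(a,b)}=(\overline a,-b)$ (and $\overline a=a$ on $A_0$) and $(a,b)(x,y)=(ax-\overline y\,b,\;ya+b\,\overline x)$. As a vector space $A_n=\mathbb R^{2^n}$; it carries the standard Euclidean inner product and norm $|\cdot|$. An element $a\in A_n$ is pure if $a+\overline a=0$. A zero divisor is an element $a\neq 0$ such that $ax=0$ for some $x\neq 0$. Corollary 4.5. Let $n\ge 3$ and let $\alpha\in A_n$ be a pure element with $|\alpha|=1$. Then there exists $\beta\in A_n$ with $\beta\perp\alpha$ and $|\beta|=1$ such that $(\alpha,\beta)$ is a zero divisor in $A_{n+1}$. Consequently, for every nonzero pure element $\alpha\in A_n$ there is a $\beta\in A_n$ such that $(\alpha,\beta)$ is a zero divisor in $A_{n+1}$. -/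

import Mathlib

/-- The underlying real vector space of the `n`-th real Cayley-Dickson algebra `A_n = ℝ^(2^n)`:
`A_0 = ℝ` and `A_{n+1} = A_n × A_n`. -/
def CD : ℕ → Type
  | 0 => ℝ
  | n + 1 => CD n × CD n

namespace CD

/-- The element `(a, b)` of `A_{n+1} = A_n × A_n`. -/
def pair {n : ℕ} (a b : CD n) : CD (n + 1) := (a, b)

/-- Coordinatewise addition (the additive group structure of `ℝ^(2^n)`). -/
noncomputable instance instAddCommGroup : (n : ℕ) → AddCommGroup (CD n)
  | 0 => inferInstanceAs (AddCommGroup ℝ)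
  | n + 1 =>
    letI := instAddCommGroup n
    inferInstanceAs (AddCommGroup (CD n × CD n))

/-- Coordinatewise real scalar multiplication. -/
noncomputable instance instModule : (n : ℕ) → Module ℝ (CD n)
  | 0 => inferInstanceAs (Module ℝ ℝ)
  | n + 1 =>
    letI := instModule n
    inferInstanceAs (Module ℝ (CD n × CD n))

/-- Conjugation: the identity on `A_0 = ℝ`, and `conj (a, b) = (conj a, -b)`. -/
noncomputable def conj : {n : ℕ} → CD n → CD n
  | 0, a => a
  | _ + 1, (a, b) => pair (conj a) (-b)

/-- Cayley-Dickson multiplication: the multiplication of real numbers on `A_0`, and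
`(a, b) (x, y) = (a x - (conj y) b, y a + b (conj x))`. -/
noncomputable def mul : {n : ℕ} → CD n → CD n → CD n
  | 0, a, x => (show ℝ from a) * (show ℝ from x)
  | _ + 1, (a, b), (x, y) =>
    pair (mul a x - mul (conj y) b) (mul y a + mul b (conj x))

noncomputable instance instMul (n : ℕ) : Mul (CD n) := ⟨mul⟩

/-- The trace `t_n : A_n → ℝ`, `t_n(a) = a + conj a` (twice the real part):
`t_0(a) = 2 a` and `t_{n+1}(a, b) = t_n(a)`. -/
noncomputable def trace : {n : ℕ} → CD n → ℝ
  | 0, a => 2 * (show ℝ from a)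
  | _ + 1, (a, _) => trace a

/-- An element is pure if its trace vanishes. -/
def IsPure {n : ℕ} (a : CD n) : Prop := trace a = 0

/-- The standard Euclidean inner product of `A_n = ℝ^(2^n)`. -/
noncomputable def innerProd : {n : ℕ} → CD n → CD n → ℝ
  | 0, a, x => (show ℝ from a) * (show ℝ from x)
  | _ + 1, (a, b), (x, y) => innerProd a x + innerProd b y

noncomputable instance instInner (n : ℕ) : Inner ℝ (CD n) := ⟨innerProd⟩

/-- The Euclidean norm of `A_n = ℝ^(2^n)`. -/
noncomputable instance instNorm (n : ℕ) : Norm (CD n) := ⟨fun a => √(inner ℝ a a)⟩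

/-- A zero divisor is a nonzero element `a` such that `a x = 0` for some nonzero `x`. -/
def IsZeroDivisor {n : ℕ} (a : CD n) : Prop := a ≠ 0 ∧ ∃ x : CD n, x ≠ 0 ∧ a * x = 0

end CD

/-!
If `x`, `y` are pure elements with `x (x u) = -u` and `y (y u) = -u` for all `u`, and
`y (a x) = -(y a) x`, then `β = y (a x)` satisfies `(a, β) (x, y) = 0`; moreover `β ⊥ a` and
`|β| = |a|`, because multiplication by `x` or `y` is a skew-adjoint isometry.

In the octonions `A_3`, which are alternative as the double of an associative algebra, any
orthonormal pure `x`, `y` with `x ⊥ a` and `y ⊥ a, a x` have these properties, since orthogonal pure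
elements anticommute; a dimension count provides such a pair. The right multiplications by `x` and
`y` also anticommute, which makes `(x, 0)`, `(y, 0)` inherit these properties for every `(a, b)`, so
the pair propagates from `A_3` to all `A_n` with `n ≥ 3`.
-/

theorem exists_norm_eq_one_forall_inner_eq_zero {ι E : Type*} [Fintype ι] [NormedAddCommGroup E]
    [InnerProductSpace ℝ E] (v : ι → E) (hv : Fintype.card ι < Module.finrank ℝ E) :
    ∃ x : E, ‖x‖ = 1 ∧ ∀ i, inner ℝ (v i) x = 0 := by
  have : FiniteDimensional ℝ E := .of_finrank_pos (by omega)
  have hspan : Submodule.span ℝ (Set.range v) ≠ ⊤ := fun h ↦ by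
    have hle : Module.finrank ℝ (Submodule.span ℝ (Set.range v)) ≤ Fintype.card ι :=
      finrank_range_le_card v
    rw [h, finrank_top] at hle
    omega
  obtain ⟨x, hx, hx₀⟩ :=
    Submodule.exists_mem_ne_zero_of_ne_bot (mt Submodule.orthogonal_eq_bot_iff.1 hspan)
  have hvx (i : ι) : inner ℝ (v i) x = 0 := hx _ (Submodule.subset_span ⟨i, rfl⟩)
  exact ⟨(‖x‖⁻¹ : ℝ) • x, norm_smul_inv_norm hx₀, fun i ↦ by
    rw [real_inner_smul_right, hvx, mul_zero]⟩

namespace CD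

variable {n : ℕ}

theorem exists_eq_pair (a : CD (n + 1)) : ∃ b c : CD n, a = pair b c := ⟨a.1, a.2, rfl⟩

theorem pair_inj {a b x y : CD n} : pair a b = pair x y ↔ a = x ∧ b = y := Prod.mk_inj

theorem zero_eq_pair : (0 : CD (n + 1)) = pair 0 0 := rfl

theorem pair_add_pair (a b x y : CD n) : pair a b + pair x y = pair (a + x) (b + y) := rfl

theorem neg_pair (a b : CD n) : -pair a b = pair (-a) (-b) := rfl

theorem smul_pair (r : ℝ) (a b : CD n) : r • pair a b = pair (r • a) (r • b) := rfl

theorem inner_pair_pair (a b x y : CD n) :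
    inner ℝ (pair a b) (pair x y) = inner ℝ a x + inner ℝ b y := rfl

theorem trace_pair (a b : CD n) : trace (pair a b) = trace a := rfl

section StarRing

/-- Conjugation as the star operation, so that Mathlib's star rings apply. -/
noncomputable scoped instance : Star (CD n) := ⟨conj⟩

theorem star_pair (a b : CD n) : star (pair a b) = pair (star a) (-b) := rfl

theorem pair_mul_pair (a b x y : CD n) :
    pair a b * pair x y = pair (a * x - star y * b) (y * a + b * star x) := rfl

protected theorem star_star : {n : ℕ} → (a : CD n) → star (star a) = a
  | 0, _ => rfl
  | n + 1, a => by
    obtain ⟨a, b, rfl⟩ := exists_eq_pair a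
    rw [star_pair, star_pair, CD.star_star a, neg_neg]

protected theorem star_add : {n : ℕ} → (a b : CD n) → star (a + b) = star a + star b
  | 0, _, _ => rfl
  | n + 1, a, b => by
    obtain ⟨a, a', rfl⟩ := exists_eq_pair a
    obtain ⟨b, b', rfl⟩ := exists_eq_pair b
    rw [pair_add_pair, star_pair, star_pair, star_pair, pair_add_pair, CD.star_add a b, neg_add]

noncomputable scoped instance : StarAddMonoid (CD n) where
  star_involutive := CD.star_star
  star_add := CD.star_add

protected theorem star_smul (r : ℝ) : {n : ℕ} → (a : CD n) → star (r • a) = r • star a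
  | 0, _ => rfl
  | n + 1, a => by
    obtain ⟨a, b, rfl⟩ := exists_eq_pair a
    rw [smul_pair, star_pair, star_pair, smul_pair, CD.star_smul r a, smul_neg]

scoped instance : StarModule ℝ (CD n) := ⟨fun r a ↦ CD.star_smul r a⟩

theorem mul_add_and_add_mul : {n : ℕ} → (a b c : CD n) →
    a * (b + c) = a * b + a * c ∧ (a + b) * c = a * c + b * c
  | 0, a, b, c => ⟨mul_add (R := ℝ) a b c, add_mul (R := ℝ) a b c⟩
  | n + 1, a, b, c => by
    obtain ⟨a, a', rfl⟩ := exists_eq_pair a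
    obtain ⟨b, b', rfl⟩ := exists_eq_pair b
    obtain ⟨c, c', rfl⟩ := exists_eq_pair c
    have left_distrib := fun x y z : CD n ↦ (mul_add_and_add_mul x y z).1
    have right_distrib := fun x y z : CD n ↦ (mul_add_and_add_mul x y z).2
    simp only [pair_add_pair, pair_mul_pair, star_add, left_distrib, right_distrib, pair_inj]
    refine ⟨⟨?_, ?_⟩, ?_, ?_⟩ <;> abel

noncomputable scoped instance instNonUnitalNonAssocRing : NonUnitalNonAssocRing (CD n) where
  left_distrib a b c := (mul_add_and_add_mul a b c).1
  right_distrib a b c := (mul_add_and_add_mul a b c).2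
  zero_mul c := (AddMonoidHom.mk' (· * c) fun a b ↦ (mul_add_and_add_mul a b c).2).map_zero
  mul_zero a := (AddMonoidHom.mk' (a * ·) fun b c ↦ (mul_add_and_add_mul a b c).1).map_zero

/-- The unit: `1` in `A_0 = ℝ` and `(1, 0)` in `A_{n+1}`. -/
noncomputable scoped instance instOne : (n : ℕ) → One (CD n)
  | 0 => ⟨(1 : ℝ)⟩
  | n + 1 =>
    letI := instOne n
    ⟨pair 1 0⟩

theorem one_eq_pair : (1 : CD (n + 1)) = pair 1 0 := rfl

protected theorem star_one : {n : ℕ} → star (1 : CD n) = 1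
  | 0 => rfl
  | n + 1 => by rw [one_eq_pair, star_pair, CD.star_one, neg_zero]

protected theorem mul_one : {n : ℕ} → (a : CD n) → a * 1 = a
  | 0, a => mul_one (M := ℝ) a
  | n + 1, a => by
    obtain ⟨a, b, rfl⟩ := exists_eq_pair a
    simp [one_eq_pair, pair_mul_pair, CD.star_one, CD.mul_one]

protected theorem one_mul : {n : ℕ} → (a : CD n) → 1 * a = a
  | 0, a => one_mul (M := ℝ) a
  | n + 1, a => by
    obtain ⟨a, b, rfl⟩ := exists_eq_pair a
    simp [one_eq_pair, pair_mul_pair, CD.one_mul, CD.mul_one]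

noncomputable scoped instance instNonAssocRing : NonAssocRing (CD n) where
  one_mul := CD.one_mul
  mul_one := CD.mul_one

protected theorem star_mul : {n : ℕ} → (a b : CD n) → star (a * b) = star b * star a
  | 0, a, b => mul_comm (G := ℝ) a b
  | n + 1, a, b => by
    obtain ⟨a, a', rfl⟩ := exists_eq_pair a
    obtain ⟨b, b', rfl⟩ := exists_eq_pair b
    simp only [pair_mul_pair, star_pair, star_sub, star_neg, star_star, CD.star_mul, neg_mul,
      mul_neg, neg_neg, neg_add_rev]

noncomputable scoped instance : StarRing (CD n) where
  star_mul := CD.star_mul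
  star_add := star_add

theorem smul_mul_and_mul_smul (r : ℝ) : {n : ℕ} → (a b : CD n) →
    r • a * b = r • (a * b) ∧ a * r • b = r • (a * b)
  | 0, a, b => ⟨smul_mul_assoc (β := ℝ) r a b, mul_smul_comm (β := ℝ) r a b⟩
  | n + 1, a, b => by
    obtain ⟨a, a', rfl⟩ := exists_eq_pair a
    obtain ⟨b, b', rfl⟩ := exists_eq_pair b
    have smul_mul := fun x y : CD n ↦ (smul_mul_and_mul_smul r x y).1
    have mul_smul := fun x y : CD n ↦ (smul_mul_and_mul_smul r x y).2
    simp only [smul_pair, pair_mul_pair, star_smul, star_trivial, smul_mul, mul_smul, smul_sub,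
      smul_add, and_self]

scoped instance : IsScalarTower ℝ (CD n) (CD n) :=
  ⟨fun r a b ↦ (smul_mul_and_mul_smul r a b).1⟩

scoped instance : SMulCommClass ℝ (CD n) (CD n) :=
  ⟨fun r a b ↦ (smul_mul_and_mul_smul r a b).2.symm⟩

end StarRing

section InnerProductSpace

protected theorem inner_comm : {n : ℕ} → (a b : CD n) → inner ℝ a b = inner ℝ b a
  | 0, a, b => mul_comm (G := ℝ) a b
  | n + 1, a, b => by
    obtain ⟨a, a', rfl⟩ := exists_eq_pair a
    obtain ⟨b, b', rfl⟩ := exists_eq_pair b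
    rw [inner_pair_pair, inner_pair_pair, CD.inner_comm a, CD.inner_comm a']

protected theorem inner_add_left : {n : ℕ} → (a b c : CD n) →
    inner ℝ (a + b) c = inner ℝ a c + inner ℝ b c
  | 0, a, b, c => add_mul (R := ℝ) a b c
  | n + 1, a, b, c => by
    obtain ⟨a, a', rfl⟩ := exists_eq_pair a
    obtain ⟨b, b', rfl⟩ := exists_eq_pair b
    obtain ⟨c, c', rfl⟩ := exists_eq_pair c
    simp only [pair_add_pair, inner_pair_pair, CD.inner_add_left]
    ring

protected theorem inner_smul_left (r : ℝ) : {n : ℕ} → (a b : CD n) →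
    inner ℝ (r • a) b = r * inner ℝ a b
  | 0, a, b => mul_assoc (G := ℝ) r a b
  | n + 1, a, b => by
    obtain ⟨a, a', rfl⟩ := exists_eq_pair a
    obtain ⟨b, b', rfl⟩ := exists_eq_pair b
    simp only [smul_pair, inner_pair_pair, CD.inner_smul_left, mul_add]

protected theorem inner_self_nonneg : {n : ℕ} → (a : CD n) → 0 ≤ inner ℝ a a
  | 0, a => mul_self_nonneg (R := ℝ) a
  | n + 1, a => by
    obtain ⟨a, b, rfl⟩ := exists_eq_pair a
    exact add_nonneg (CD.inner_self_nonneg a) (CD.inner_self_nonneg b)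

theorem eq_zero_of_inner_self_eq_zero : {n : ℕ} → {a : CD n} → inner ℝ a a = 0 → a = 0
  | 0, _, h => mul_self_eq_zero (M₀ := ℝ).1 h
  | n + 1, a, h => by
    obtain ⟨a, b, rfl⟩ := exists_eq_pair a
    rw [inner_pair_pair, add_eq_zero_iff_of_nonneg (CD.inner_self_nonneg a)
      (CD.inner_self_nonneg b)] at h
    exact pair_inj.2 ⟨eq_zero_of_inner_self_eq_zero h.1, eq_zero_of_inner_self_eq_zero h.2⟩

/-- The inner product space axioms for the Euclidean inner product of `A_n`. -/
@[reducible]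
noncomputable def innerCore (n : ℕ) : InnerProductSpace.Core ℝ (CD n) where
  toInner := instInner n
  conj_inner_symm a b := CD.inner_comm b a
  re_inner_nonneg := CD.inner_self_nonneg
  add_left := CD.inner_add_left
  smul_left a b r := CD.inner_smul_left r a b
  definite _ := eq_zero_of_inner_self_eq_zero

/-- The Euclidean normed group structure; `toNorm` is set explicitly so that `‖·‖` unfolds to
`CD.instNorm`. -/
noncomputable scoped instance : NormedAddCommGroup (CD n) :=
  { (innerCore n).toNormedAddCommGroup with toNorm := instNorm n }

/-- The Euclidean inner product space structure; `toModule` and `toInner` are set explicitly so that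
they unfold to the existing instances. -/
noncomputable scoped instance : InnerProductSpace ℝ (CD n) :=
  { InnerProductSpace.ofCore (innerCore n).toCore with
    toModule := instModule n
    toInner := instInner n }

scoped instance instModuleFinite : (n : ℕ) → Module.Finite ℝ (CD n)
  | 0 => inferInstanceAs (Module.Finite ℝ ℝ)
  | n + 1 =>
    letI := instModuleFinite n
    inferInstanceAs (Module.Finite ℝ (CD n × CD n))

theorem finrank_eq_two_pow : (n : ℕ) → Module.finrank ℝ (CD n) = 2 ^ n
  | 0 => Module.finrank_self ℝ
  | n + 1 => by
    have h : Module.finrank ℝ (CD (n + 1)) = Module.finrank ℝ (CD n × CD n) := rfl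
    rw [h, Module.finrank_prod, finrank_eq_two_pow, pow_succ, mul_two]

theorem inner_star_star : {n : ℕ} → (a b : CD n) → inner ℝ (star a) (star b) = inner ℝ a b
  | 0, _, _ => rfl
  | n + 1, a, b => by
    obtain ⟨a, a', rfl⟩ := exists_eq_pair a
    obtain ⟨b, b', rfl⟩ := exists_eq_pair b
    simp only [star_pair, inner_pair_pair, inner_star_star a b, inner_neg_neg]

theorem inner_mul_right_of_inner_mul_left
    (h : ∀ a b c : CD n, inner ℝ (a * b) c = inner ℝ b (star a * c)) (a b c : CD n) :
    inner ℝ (a * b) c = inner ℝ a (c * star b) := by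
  rw [← inner_star_star, star_mul, h, ← inner_star_star, star_mul, star_star, star_star, star_star]

theorem inner_mul_left : {n : ℕ} → (a b c : CD n) → inner ℝ (a * b) c = inner ℝ b (star a * c)
  | 0, a, b, c => (mul_assoc (G := ℝ) a b c).trans (mul_left_comm (G := ℝ) a b c)
  | n + 1, a, b, c => by
    obtain ⟨a, a', rfl⟩ := exists_eq_pair a
    obtain ⟨b, b', rfl⟩ := exists_eq_pair b
    obtain ⟨c, c', rfl⟩ := exists_eq_pair c
    have right := inner_mul_right_of_inner_mul_left (n := n) inner_mul_left
    have h₁ : inner ℝ (star b' * a') c = inner ℝ b' (a' * star c) := by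
      rw [right, ← inner_star_star, star_star, star_mul, star_star]
    have h₂ : inner ℝ (a' * star b) c' = inner ℝ b (star c' * a') := by
      rw [inner_mul_left, ← inner_star_star, star_star, star_mul, star_star]
    simp only [star_pair, pair_mul_pair, inner_pair_pair, inner_add_left, inner_add_right,
      inner_sub_left, inner_sub_right, mul_neg, neg_mul, inner_neg_right, h₁, h₂,
      inner_mul_left a b c, right b' a c']
    ring

theorem inner_mul_right (a b c : CD n) : inner ℝ (a * b) c = inner ℝ a (c * star b) :=
  inner_mul_right_of_inner_mul_left inner_mul_left a b c

theorem star_mul_add_star_mul : {n : ℕ} → (a b : CD n) →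
    star a * b + star b * a = (2 * inner ℝ a b) • (1 : CD n)
  | 0, a, b => by
    have h (r s : ℝ) : r * s + s * r = 2 * (r * s) * 1 := by ring
    exact h a b
  | n + 1, a, b => by
    obtain ⟨a, a', rfl⟩ := exists_eq_pair a
    obtain ⟨b, b', rfl⟩ := exists_eq_pair b
    simp only [star_pair, pair_mul_pair, pair_add_pair, inner_pair_pair, one_eq_pair, smul_pair,
      pair_inj, mul_add, add_smul, ← star_mul_add_star_mul, smul_zero, mul_neg, neg_mul]
    constructor <;> abel

theorem mul_star_add_mul_star (a b : CD n) :
    a * star b + b * star a = (2 * inner ℝ a b) • (1 : CD n) := by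
  simpa only [star_star, inner_star_star] using star_mul_add_star_mul (star a) (star b)

end InnerProductSpace

section Doubling

theorem star_eq_self_zero (a : CD 0) : star a = a := rfl

theorem mul_comm_zero (a b : CD 0) : a * b = b * a := mul_comm (G := ℝ) a b

theorem mul_assoc_zero (a b c : CD 0) : a * b * c = a * (b * c) := mul_assoc (G := ℝ) a b c

theorem mul_comm_succ (hstar : ∀ a : CD n, star a = a) (hcomm : ∀ a b : CD n, a * b = b * a)
    (a b : CD (n + 1)) : a * b = b * a := by
  obtain ⟨a, a', rfl⟩ := exists_eq_pair a
  obtain ⟨b, b', rfl⟩ := exists_eq_pair b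
  simp only [pair_mul_pair, hstar, pair_inj]
  exact ⟨by rw [hcomm a b, hcomm b' a'], by rw [hcomm b' a, hcomm a' b, add_comm]⟩

theorem mul_assoc_succ (hassoc : ∀ a b c : CD n, a * b * c = a * (b * c))
    (hcomm : ∀ a b : CD n, a * b = b * a) (a b c : CD (n + 1)) : a * b * c = a * (b * c) := by
  obtain ⟨a, a', rfl⟩ := exists_eq_pair a
  obtain ⟨b, b', rfl⟩ := exists_eq_pair b
  obtain ⟨c, c', rfl⟩ := exists_eq_pair c
  let : CommRing (CD n) := { instNonAssocRing with mul_assoc := hassoc, mul_comm := hcomm }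
  simp only [pair_mul_pair, star_sub, star_add, star_mul, star_star, pair_inj]
  constructor <;> ring

/-- The polarized form of `x̄ (x u) = |x|² u`: the algebra `A_{n+1}` is alternative when `A_n` is
associative. -/
theorem star_mul_mul_add_star_mul_mul (hassoc : ∀ a b c : CD n, a * b * c = a * (b * c))
    (x y u : CD (n + 1)) :
    star x * (y * u) + star y * (x * u) = (2 * inner ℝ x y) • u := by
  obtain ⟨x, x', rfl⟩ := exists_eq_pair x
  obtain ⟨y, y', rfl⟩ := exists_eq_pair y
  obtain ⟨u, u', rfl⟩ := exists_eq_pair u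
  have left_star_mul (x y v : CD n) :
      star x * (y * v) + star y * (x * v) = (2 * inner ℝ x y) • v := by
    rw [← hassoc, ← hassoc, ← add_mul, star_mul_add_star_mul, smul_one_mul]
  have right_star_mul (x y v : CD n) :
      v * star x * y + v * star y * x = (2 * inner ℝ x y) • v := by
    rw [hassoc, hassoc, ← mul_add, star_mul_add_star_mul, mul_smul_one]
  have right_mul_star (x y v : CD n) :
      v * x * star y + v * y * star x = (2 * inner ℝ x y) • v := by
    rw [hassoc, hassoc, ← mul_add, mul_star_add_mul_star, mul_smul_one]
  have left_mul_star (x y v : CD n) :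
      x * (star y * v) + y * (star x * v) = (2 * inner ℝ x y) • v := by
    rw [← hassoc, ← hassoc, ← add_mul, mul_star_add_mul_star, smul_one_mul]
  simp only [pair_mul_pair, star_pair, pair_add_pair, inner_pair_pair, smul_pair, pair_inj,
    star_sub, star_add, star_mul, star_star, mul_add (2 : ℝ), add_smul]
  constructor
  · rw [← left_star_mul x y u, ← right_star_mul x' y' u]
    simp only [add_mul, mul_sub, mul_neg, hassoc]
    abel
  · rw [← right_mul_star x y u', ← left_mul_star x' y' u']
    simp only [add_mul, mul_sub, neg_mul, hassoc]
    abel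

theorem mul_mul_star_add_mul_mul_star (hassoc : ∀ a b c : CD n, a * b * c = a * (b * c))
    (x y u : CD (n + 1)) :
    u * x * star y + u * y * star x = (2 * inner ℝ x y) • u := by
  have h := congrArg star (star_mul_mul_add_star_mul_mul hassoc (star y) (star x) (star u))
  simpa only [star_add, star_mul, star_star, star_smul, star_trivial, inner_star_star,
    real_inner_comm x y] using h

theorem mul_assoc_two (a b c : CD 2) : a * b * c = a * (b * c) :=
  mul_assoc_succ (mul_assoc_succ mul_assoc_zero mul_comm_zero)
    (mul_comm_succ star_eq_self_zero mul_comm_zero) a b c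

end Doubling

section Pure

theorem trace_eq_two_mul_inner_one : {n : ℕ} → (a : CD n) → trace a = 2 * inner ℝ 1 a
  | 0, a => congrArg (2 * ·) (one_mul (M := ℝ) a).symm
  | n + 1, a => by
    obtain ⟨a, b, rfl⟩ := exists_eq_pair a
    rw [trace_pair, one_eq_pair, inner_pair_pair, inner_zero_left, add_zero,
      trace_eq_two_mul_inner_one]

theorem isPure_iff_inner_one_eq_zero {a : CD n} : IsPure a ↔ inner ℝ 1 a = 0 := by
  rw [IsPure, trace_eq_two_mul_inner_one, mul_eq_zero_iff_left two_ne_zero]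

theorem IsPure.star_eq {a : CD n} (ha : IsPure a) : star a = -a := by
  have h := star_mul_add_star_mul 1 a
  rw [isPure_iff_inner_one_eq_zero.1 ha, star_one, one_mul, mul_one, mul_zero, zero_smul] at h
  exact (neg_eq_of_add_eq_zero_right h).symm

theorem IsPure.mul_eq_neg_mul {a b : CD n} (ha : IsPure a) (hb : IsPure b)
    (hab : inner ℝ a b = 0) : a * b = -(b * a) := by
  have h := star_mul_add_star_mul a b
  rw [ha.star_eq, hb.star_eq, hab, mul_zero, zero_smul, neg_mul, neg_mul, ← neg_add,
    neg_eq_zero] at h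
  exact eq_neg_of_add_eq_zero_left h

theorem IsPure.mul {a b : CD n} (ha : IsPure a) (hab : inner ℝ a b = 0) : IsPure (a * b) := by
  rw [isPure_iff_inner_one_eq_zero, real_inner_comm, inner_mul_left, mul_one, ha.star_eq,
    inner_neg_right, real_inner_comm, hab, neg_zero]

theorem IsPure.inner_mul_left {a : CD n} (ha : IsPure a) (b c : CD n) :
    inner ℝ (a * b) c = -inner ℝ b (a * c) := by
  rw [CD.inner_mul_left, ha.star_eq, neg_mul, inner_neg_right]

theorem IsPure.inner_mul_right {b : CD n} (hb : IsPure b) (a c : CD n) :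
    inner ℝ (a * b) c = -inner ℝ a (c * b) := by
  rw [CD.inner_mul_right, hb.star_eq, mul_neg, inner_neg_right]

end Pure

/-- A pure element `x` with `x * (x * u) = -u` for all `u`: an alternative element in the sense of
Moreno, normalized so that `x * x = -1`. -/
structure IsAlternativeUnit (x : CD n) : Prop where
  isPure : IsPure x
  mul_mul_self_left (u : CD n) : x * (x * u) = -u

namespace IsAlternativeUnit

variable {x : CD n}

theorem mul_mul_self_right (hx : IsAlternativeUnit x) (u : CD n) : u * x * x = -u := by
  have h := congrArg star (hx.mul_mul_self_left (star u))
  simpa only [star_mul, star_neg, star_star, hx.isPure.star_eq, mul_neg, neg_mul, neg_neg] using h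

theorem norm_mul_left (hx : IsAlternativeUnit x) (u : CD n) : ‖x * u‖ = ‖u‖ := by
  rw [norm_eq_sqrt_real_inner, hx.isPure.inner_mul_left, hx.mul_mul_self_left, inner_neg_right,
    neg_neg, ← norm_eq_sqrt_real_inner]

theorem norm_mul_right (hx : IsAlternativeUnit x) (u : CD n) : ‖u * x‖ = ‖u‖ := by
  rw [norm_eq_sqrt_real_inner, hx.isPure.inner_mul_right, hx.mul_mul_self_right, inner_neg_right,
    neg_neg, ← norm_eq_sqrt_real_inner]

end IsAlternativeUnit

theorem pair_zero_mul_pair (x u v : CD n) : pair x 0 * pair u v = pair (x * u) (v * x) := by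
  rw [pair_mul_pair, mul_zero, zero_mul, sub_zero, add_zero]

theorem IsPure.pair_mul_pair_zero {x : CD n} (hx : IsPure x) (u v : CD n) :
    pair u v * pair x 0 = pair (u * x) (-(v * x)) := by
  rw [pair_mul_pair, star_zero, zero_mul, zero_mul, sub_zero, zero_add, hx.star_eq, mul_neg]

theorem isPure_pair {a b : CD n} : IsPure (pair a b) ↔ IsPure a := Iff.rfl

theorem IsAlternativeUnit.pair_zero {x : CD n} (hx : IsAlternativeUnit x) :
    IsAlternativeUnit (pair x 0) where
  isPure := isPure_pair.2 hx.isPure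
  mul_mul_self_left u := by
    obtain ⟨u, v, rfl⟩ := exists_eq_pair u
    rw [pair_zero_mul_pair, pair_zero_mul_pair, hx.mul_mul_self_left, hx.mul_mul_self_right,
      neg_pair]

/-- Alternative units `x`, `y` whose right multiplications anticommute, and for which the left
multiplication by `y` and the right multiplication by `x` anticommute at `a`. Then
`pair a (y * (a * x))` annihilates `pair x y`. -/
structure IsTwistingPair (a x y : CD n) : Prop where
  left : IsAlternativeUnit x
  right : IsAlternativeUnit y
  mul_mul_anticomm (u : CD n) : u * x * y = -(u * y * x)
  twist : y * (a * x) = -(y * a * x)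

namespace IsTwistingPair

variable {a x y : CD n}

theorem pair_zero (h : IsTwistingPair a x y) (b : CD n) :
    IsTwistingPair (pair a b) (pair x 0) (pair y 0) where
  left := h.left.pair_zero
  right := h.right.pair_zero
  mul_mul_anticomm u := by
    obtain ⟨u, v, rfl⟩ := exists_eq_pair u
    simp only [h.left.isPure.pair_mul_pair_zero, h.right.isPure.pair_mul_pair_zero, neg_mul,
      neg_neg, neg_pair, h.mul_mul_anticomm u, h.mul_mul_anticomm v]
  twist := by
    rw [h.left.isPure.pair_mul_pair_zero, pair_zero_mul_pair, pair_zero_mul_pair,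
      h.left.isPure.pair_mul_pair_zero, neg_pair, neg_neg, neg_mul, h.twist, h.mul_mul_anticomm b,
      neg_neg]

theorem inner_mul_mul_eq_zero (h : IsTwistingPair a x y) : inner ℝ a (y * (a * x)) = 0 := by
  have h_left : inner ℝ a (y * (a * x)) = -inner ℝ (y * a) (a * x) := by
    rw [h.right.isPure.inner_mul_left, neg_neg]
  have h_right : inner ℝ a (y * (a * x)) = inner ℝ (y * a) (a * x) := by
    rw [h.twist, inner_neg_right, real_inner_comm, h.left.isPure.inner_mul_right, neg_neg]
  linarith

theorem norm_mul_mul (h : IsTwistingPair a x y) : ‖y * (a * x)‖ = ‖a‖ := by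
  rw [h.right.norm_mul_left, h.left.norm_mul_right]

theorem pair_mul_pair_eq_zero (h : IsTwistingPair a x y) :
    pair a (y * (a * x)) * pair x y = 0 := by
  rw [pair_mul_pair, h.left.isPure.star_eq, h.right.isPure.star_eq, zero_eq_pair, pair_inj]
  constructor
  · rw [neg_mul, h.right.mul_mul_self_left, neg_neg, sub_self]
  · rw [h.twist, neg_mul_neg, h.left.mul_mul_self_right, add_neg_cancel]

theorem isZeroDivisor_pair (h : IsTwistingPair a x y) (ha : a ≠ 0) :
    IsZeroDivisor (pair a (y * (a * x))) := by
  have hax : a * x ≠ 0 := by rwa [← norm_ne_zero_iff, h.left.norm_mul_right, norm_ne_zero_iff]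
  exact ⟨fun h₀ ↦ ha (pair_inj.1 h₀).1, pair x y,
    fun h₀ ↦ right_ne_zero_of_mul hax (pair_inj.1 h₀).1, h.pair_mul_pair_eq_zero⟩

end IsTwistingPair

theorem exists_isPure_norm_eq_one_forall_inner_eq_zero {ι : Type*} [Fintype ι]
    (v : ι → CD n) (hv : Fintype.card ι + 1 < 2 ^ n) :
    ∃ x : CD n, IsPure x ∧ ‖x‖ = 1 ∧ ∀ i, inner ℝ (v i) x = 0 := by
  obtain ⟨x, hx, hvx⟩ := exists_norm_eq_one_forall_inner_eq_zero (fun o : Option ι ↦ o.elim 1 v)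
    (by rwa [Fintype.card_option, finrank_eq_two_pow])
  exact ⟨x, isPure_iff_inner_one_eq_zero.2 (hvx none), hx, fun i ↦ hvx (some i)⟩

theorem IsPure.isAlternativeUnit_of_norm_eq_one (hassoc : ∀ a b c : CD n, a * b * c = a * (b * c))
    {x : CD (n + 1)} (hx : IsPure x) (hnorm : ‖x‖ = 1) : IsAlternativeUnit x where
  isPure := hx
  mul_mul_self_left u := by
    have h := star_mul_mul_add_star_mul_mul hassoc x x u
    rw [real_inner_self_eq_norm_sq, hnorm, one_pow, mul_one, hx.star_eq, neg_mul, ← two_smul ℝ,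
      smul_right_inj two_ne_zero] at h
    exact neg_eq_iff_eq_neg.1 h

theorem IsPure.mul_mul_anticomm (hassoc : ∀ a b c : CD n, a * b * c = a * (b * c))
    {x y : CD (n + 1)} (hx : IsPure x) (hy : IsPure y) (hxy : inner ℝ x y = 0) (u : CD (n + 1)) :
    u * x * y = -(u * y * x) := by
  have h := mul_mul_star_add_mul_mul_star hassoc x y u
  rw [hx.star_eq, hy.star_eq, hxy, mul_zero, zero_smul, mul_neg, mul_neg, ← neg_add,
    neg_eq_zero] at h
  exact eq_neg_of_add_eq_zero_left h

theorem IsPure.mul_mul_twist (hassoc : ∀ a b c : CD n, a * b * c = a * (b * c))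
    {a x y : CD (n + 1)} (ha : IsPure a) (hx : IsPure x) (hy : IsPure y) (hax : inner ℝ a x = 0)
    (hay : inner ℝ a y = 0) (hxy : inner ℝ x y = 0) (haxy : inner ℝ (a * x) y = 0) :
    y * (a * x) = -(y * a * x) :=
  calc
    y * (a * x) = -(a * x * y) := by rw [(ha.mul hax).mul_eq_neg_mul hy haxy, neg_neg]
    _ = a * y * x := by rw [hx.mul_mul_anticomm hassoc hy hxy, neg_neg]
    _ = -(y * a * x) := by rw [ha.mul_eq_neg_mul hy hay, neg_mul]

theorem IsPure.exists_isTwistingPair_three {a : CD 3} (ha : IsPure a) :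
    ∃ x y, IsTwistingPair a x y := by
  obtain ⟨x, hx, hx_norm, hax⟩ :=
    exists_isPure_norm_eq_one_forall_inner_eq_zero ![a] (by simp)
  obtain ⟨y, hy, hy_norm, hay⟩ :=
    exists_isPure_norm_eq_one_forall_inner_eq_zero ![a, x, a * x] (by simp)
  exact ⟨x, y, hx.isAlternativeUnit_of_norm_eq_one mul_assoc_two hx_norm,
    hy.isAlternativeUnit_of_norm_eq_one mul_assoc_two hy_norm,
    hx.mul_mul_anticomm mul_assoc_two hy (hay 1),
    ha.mul_mul_twist mul_assoc_two hx hy (hax 0) (hay 0) (hay 1) (hay 2)⟩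

theorem IsPure.exists_isTwistingPair (hn : 3 ≤ n) {a : CD n} (ha : IsPure a) :
    ∃ x y, IsTwistingPair a x y := by
  induction n, hn using Nat.le_induction with
  | base => exact ha.exists_isTwistingPair_three
  | succ n _ ih =>
    obtain ⟨a, b, rfl⟩ := exists_eq_pair a
    obtain ⟨x, y, h⟩ := ih (isPure_pair.1 ha)
    exact ⟨pair x 0, pair y 0, h.pair_zero b⟩

theorem IsPure.exists_isZeroDivisor_pair (hn : 3 ≤ n) {α : CD n} (hα : IsPure α) (hα₀ : α ≠ 0) :
    ∃ β : CD n, inner ℝ α β = 0 ∧ ‖β‖ = ‖α‖ ∧ IsZeroDivisor (pair α β) := by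
  obtain ⟨x, y, h⟩ := hα.exists_isTwistingPair hn
  exact ⟨y * (α * x), h.inner_mul_mul_eq_zero, h.norm_mul_mul, h.isZeroDivisor_pair hα₀⟩

end CD

theorem corollary4p5 (n : ℕ) (hn : 3 ≤ n) :
    (∀ α : CD n, CD.IsPure α → ‖α‖ = 1 →
      ∃ β : CD n, inner ℝ α β = 0 ∧ ‖β‖ = 1 ∧ CD.IsZeroDivisor (CD.pair α β)) ∧
    (∀ α : CD n, CD.IsPure α → α ≠ 0 →
      ∃ β : CD n, CD.IsZeroDivisor (CD.pair α β)) := by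
  refine ⟨fun α hα hnorm ↦ ?_, fun α hα hα₀ ↦ ?_⟩
  · have hα₀ : α ≠ 0 := open scoped CD in ne_zero_of_norm_ne_zero (hnorm ▸ one_ne_zero)
    simpa only [hnorm] using hα.exists_isZeroDivisor_pair hn hα₀
  · obtain ⟨β, -, -, hβ⟩ := hα.exists_isZeroDivisor_pair hn hα₀
    exact ⟨β, hβ⟩
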